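/- Let $N\ge 0$ be an integer and let $d^2z$ denote Lebesgue measure on $\mathbb C$. For a measurable potential $W:\mathbb C\to[-\infty,\infty]$ (with $e^{-\infty}=0$, and $0\cdot\infty=0$ in products) define the partition function of the planar symplectic ensemble, $$Z_N^{\mathbb H}(W)=\frac1{N!}\int_{\mathbb C^N}\ \prod_{j=1}^N e^{-2W(z_j)}|z_j-\bar z_j|^2\prod_{1\le j<k\le N}|z_k-z_j|^2|z_k-\bar z_j|^2\ \prod_{j=1}^N d^2z_j ,$$ and the partition function of the complex normal-matrix ensemble, $$Z_N^{\mathbb C}(W)=\frac1{N!}\int_{\mathbb C^N}\ \prod_{j=1}^N e^{-W(z_j)}\prod_{1\le j<k\le N}|z_k-z_j|^2\ \prod_{j=1}^N d^2z_j ,$$ both as elements of $[0,\infty]$. Let $\omega_{\mathbb C}:[0,\infty)\to[-\infty,\infty]$ be measurable, let $W_{\mathbb C}(z)=\omega_{\mathbb C}(|z|)$ be the corresponding radially symmetric potential, and let $W_{\mathbb H}(z)=\tfrac12\,\omega_{\mathbb C}(|z|^2)$. Then $$Z_N^{\mathbb H}(W_{\mathbb H})=Z_N^{\mathbb C}(W_{\mathbb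 C}).$$ In particular, one side is finite if and only if the other is. -/

import Mathlib

open MeasureTheory
open scoped ENNReal NNReal ComplexConjugate Nat

noncomputable section

/-- The partition function `Z_N^ℍ(W) ∈ [0, ∞]` of the planar symplectic ensemble with potential `W`:
`1 / N!` times the integral over `ℂ^N`, against Lebesgue measure, of
`∏_j e^{-2 W(z_j)} |z_j - conj z_j|^2 * ∏_{j < k} |z_k - z_j|^2 |z_k - conj z_j|^2`.
The potential may take the values `±∞`, with `e^{-∞} = 0`. -/
def symplecticPartitionFunction (N : ℕ) (W : ℂ → EReal) : ℝ≥0∞ :=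
  (N ! : ℝ≥0∞)⁻¹ * ∫⁻ z : Fin N → ℂ,
    (∏ j, EReal.exp (-(2 * W (z j))) * ‖z j - conj (z j)‖ₑ ^ 2) *
      ∏ j, ∏ k ∈ Finset.Ioi j, ‖z k - z j‖ₑ ^ 2 * ‖z k - conj (z j)‖ₑ ^ 2

/-- The partition function `Z_N^ℂ(W) ∈ [0, ∞]` of the complex normal matrix ensemble with
potential `W`: `1 / N!` times the integral over `ℂ^N`, against Lebesgue measure, of
`∏_j e^{-W(z_j)} * ∏_{j < k} |z_k - z_j|^2`. -/
def normalPartitionFunction (N : ℕ) (W : ℂ → EReal) : ℝ≥0∞ :=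
  (N ! : ℝ≥0∞)⁻¹ * ∫⁻ z : Fin N → ℂ,
    (∏ j, EReal.exp (-W (z j))) * ∏ j, ∏ k ∈ Finset.Ioi j, ‖z k - z j‖ₑ ^ 2

end

/-!
Both densities have a radial one-particle weight, so the remaining polynomial factor may be averaged
over independent rotations of the particles (`lintegral_eq_of_sum_rotation_eq`). Finitely many
rotations suffice: averaging over `M`-th roots of unity with `M` above all exponents already kills
every monomial `z ^ a * conj z ^ b` with `a ≠ b` (`sum_rotation_monomial`). Only finite sums are
interchanged with the integral of a nonnegative function, so no integrability is needed and the
weights and the partition functions may be infinite.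

For the complex ensemble, the average of `|Δ(z)|²` is the permanent of `(|z_j| ^ (2 i))`
(`sum_rotation_normal`), whence `Z_N^ℂ = ∏_{i < N} ∫ e^{-W} |z|^{2 i}`. For the symplectic ensemble,
the polynomial factor is `∏ (z_j - conj z_j)` times the Vandermonde determinant of the `2 N`
variables `z_1, conj z_1, …, z_N, conj z_N` (`det_vandermonde_pairs`). Averaging keeps only
those terms of its Leibniz expansion in which the two exponents at each `z_j` are consecutive
numbers. As `0, …, 2 N - 1` can be matched into consecutive numbers in only one way
(`mem_range_blockPerm_of_consecutive`), the surviving permutations permute the pairs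
`{2 i, 2 i + 1}`. The average is the permanent of `(2 |z_j| ^ (4 i + 2))`
(`sum_rotation_symplectic`), whence `Z_N^ℍ = ∏_{i < N} ∫ 2 e^{-2 W} |z|^{4 i + 2}`.

The two products agree factor by factor under the substitution `s = |z|²` in polar coordinates
(`lintegral_norm_sq`).
-/

/-! ### Averages over roots of unity -/

/-- Discrete orthogonality: rotating `z` through the `M`-th roots of unity kills
`z ^ a * conj z ^ b` unless `a = b`, as long as both exponents are below `M`. -/
theorem sum_rotation_monomial {M : ℕ} {ζ : ℂ} (hζ : IsPrimitiveRoot ζ M) (z : ℂ) {a b : ℕ}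
    (ha : a < M) (hb : b < M) :
    ∑ k : Fin M, (ζ ^ (k : ℕ) * z) ^ a * conj (ζ ^ (k : ℕ) * z) ^ b =
      if a = b then (M : ℂ) * ((‖z‖ : ℝ) : ℂ) ^ (2 * a) else 0 := by
  have hM : M ≠ 0 := by omega
  have h0 : ζ ≠ 0 := hζ.ne_zero hM
  have hn : ‖ζ‖ = 1 := hζ.norm'_eq_one hM
  have hc : conj ζ = ζ⁻¹ := (Complex.inv_eq_conj hn).symm
  have key : ∀ k : ℕ, (ζ ^ k * z) ^ a * conj (ζ ^ k * z) ^ b =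
      (ζ ^ a / ζ ^ b) ^ k * (z ^ a * conj z ^ b) := by
    intro k
    rw [map_mul, map_pow, hc]
    field_simp
    ring
  simp only [key, ← Finset.sum_mul]
  rw [Fin.sum_univ_eq_sum_range (fun k => (ζ ^ a / ζ ^ b) ^ k) M]
  split_ifs with hab
  · subst hab
    rw [div_self (pow_ne_zero _ h0), ← mul_pow, Complex.mul_conj']
    simp [pow_mul]
  · have h1 : ζ ^ a / ζ ^ b ≠ 1 := by
      rw [ne_eq, div_eq_one_iff_eq (pow_ne_zero _ h0)]
      exact fun h => hab (hζ.pow_inj ha hb h)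
    rw [geom_sum_eq h1, div_pow, ← pow_mul, ← pow_mul, mul_comm a, mul_comm b, pow_mul, pow_mul,
      hζ.pow_eq_one]
    simp

/-- Rotating the coordinates independently turns a sum of products of one-variable functions into
the sum of the products of their one-variable rotation sums. -/
theorem sum_rotation_prod {N M : ℕ} {S : Type*} [Fintype S] (c : S → ℂ) (f : S → Fin N → ℂ → ℂ)
    (ζ : ℂ) (z : Fin N → ℂ) :
    ∑ u : Fin N → Fin M, ∑ s, c s * ∏ j, f s j (ζ ^ (u j : ℕ) * z j) =
      ∑ s, c s * ∏ j, ∑ k : Fin M, f s j (ζ ^ (k : ℕ) * z j) := by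
  rw [Finset.sum_comm]
  simp only [← Finset.mul_sum, Finset.prod_univ_sum, Fintype.piFinset_univ]

/-- Against a rotation-invariant weight, `F` may be replaced by its average `Q` over rotations of
the coordinates by `M`-th roots of unity. The weight may take the value `∞`. -/
theorem lintegral_eq_of_sum_rotation_eq {N M : ℕ} (hM : M ≠ 0) {ζ : ℂ} (hζ : ‖ζ‖ = 1)
    {w : ℂ → ℝ≥0∞} (hw : Measurable w) (hrad : ∀ c z, ‖c‖ = 1 → w (c * z) = w z)
    {F Q : (Fin N → ℂ) → ℝ≥0∞} (hF : Measurable F)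
    (hFQ : ∀ z, ∑ u : Fin N → Fin M, F (fun j => ζ ^ (u j : ℕ) * z j) = (M : ℝ≥0∞) ^ N * Q z) :
    ∫⁻ z : Fin N → ℂ, (∏ j, w (z j)) * F z = ∫⁻ z : Fin N → ℂ, (∏ j, w (z j)) * Q z := by
  have hG : Measurable fun z : Fin N → ℂ => (∏ j, w (z j)) * F z :=
    (Finset.measurable_prod _ fun j _ => hw.comp (measurable_pi_apply j)).mul hF
  have hn : ∀ k : ℕ, ‖ζ ^ k‖ = 1 := fun k => by rw [norm_pow, hζ, one_pow]
  have hmp : ∀ u : Fin N → Fin M,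
      MeasurePreserving (fun (z : Fin N → ℂ) j => ζ ^ (u j : ℕ) * z j) := fun u =>
    volume_preserving_pi (f := fun j x => ζ ^ (u j : ℕ) * x) fun j =>
      (rotation ⟨ζ ^ (u j : ℕ), mem_sphere_zero_iff_norm.2 (hn _)⟩).measurePreserving
  have hMN : (M : ℝ≥0∞) ^ N ≠ 0 := pow_ne_zero _ (by exact_mod_cast hM)
  have hMN' : (M : ℝ≥0∞) ^ N ≠ ∞ := ENNReal.pow_ne_top (ENNReal.natCast_ne_top M)
  rw [← ENNReal.mul_right_inj hMN hMN']
  calc (M : ℝ≥0∞) ^ N * ∫⁻ z : Fin N → ℂ, (∏ j, w (z j)) * F z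
      = ∑ u : Fin N → Fin M, ∫⁻ z : Fin N → ℂ, (∏ j, w (z j)) * F z := by simp
    _ = ∑ u : Fin N → Fin M, ∫⁻ z : Fin N → ℂ,
          (∏ j, w (z j)) * F fun j => ζ ^ (u j : ℕ) * z j := by
        refine Finset.sum_congr rfl fun u _ => ?_
        rw [← (hmp u).lintegral_comp hG]
        simp only [hrad _ _ (hn _)]
    _ = (M : ℝ≥0∞) ^ N * ∫⁻ z : Fin N → ℂ, (∏ j, w (z j)) * Q z := by
        rw [← lintegral_finsetSum, ← lintegral_const_mul' _ _ hMN']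
        · refine lintegral_congr fun z => ?_
          rw [← Finset.mul_sum, hFQ]
          ring
        · intro u _
          exact (Finset.measurable_prod _ fun j _ => hw.comp (measurable_pi_apply j)).mul
            (hF.comp (hmp u).measurable)

/-! ### Integrals of products -/

theorem lintegral_fin_prod_eq_prod {n : ℕ} {E : Type*} [MeasureSpace E]
    [SigmaFinite (volume : Measure E)] (f : Fin n → E → ℝ≥0∞) (hf : ∀ i, Measurable (f i)) :
    ∫⁻ x : Fin n → E, ∏ i, f i (x i) = ∏ i, ∫⁻ x, f i x := by
  induction n with
  | zero => simp [volume_pi]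
  | succ n ih =>
    calc
      _ = ∫⁻ x : E × (Fin n → E), f 0 x.1 * ∏ i : Fin n, f i.succ (x.2 i) := by
        rw [volume_pi, ← ((measurePreserving_piFinSuccAbove
          (fun _ => (volume : Measure E)) 0).symm).lintegral_comp_emb
            (MeasurableEquiv.measurableEmbedding _)]
        refine lintegral_congr fun x => ?_
        rw [Fin.prod_univ_succ]
        rfl
      _ = (∫⁻ x, f 0 x) * ∏ i : Fin n, ∫⁻ x, f i.succ x := by
        rw [← ih _ fun i => hf i.succ, ← lintegral_prod_mul (hf 0).aemeasurable,
          Measure.volume_eq_prod]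
        exact (Finset.measurable_prod _
          fun i _ => (hf i.succ).comp (measurable_pi_apply i)).aemeasurable
      _ = _ := by rw [Fin.prod_univ_succ]

/-- The integral of a permanent: every permutation contributes the same product. -/
theorem lintegral_sum_perm_eq {N : ℕ} {w : ℂ → ℝ≥0∞} (hw : Measurable w) {q : Fin N → ℂ → ℝ≥0∞}
    (hq : ∀ i, Measurable (q i)) :
    ∫⁻ z : Fin N → ℂ, (∏ j, w (z j)) * ∑ σ : Equiv.Perm (Fin N), ∏ j, q (σ j) (z j) =
      N ! * ∏ i, ∫⁻ z, w z * q i z := by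
  simp only [Finset.mul_sum, ← Finset.prod_mul_distrib]
  rw [lintegral_finsetSum]
  · have h : ∀ σ : Equiv.Perm (Fin N), ∫⁻ z : Fin N → ℂ, ∏ j, w (z j) * q (σ j) (z j) =
        ∏ i, ∫⁻ z, w z * q i z := fun σ => by
      rw [lintegral_fin_prod_eq_prod (fun j z => w z * q (σ j) z) fun j => hw.mul (hq _)]
      exact Equiv.prod_comp σ fun i => ∫⁻ z, w z * q i z
    simp [h, Fintype.card_perm]
  · intro σ _
    exact Finset.measurable_prod _ fun j _ =>
      (hw.mul (hq (σ j))).comp (measurable_pi_apply j)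

/-! ### Radial integrals on the plane -/

/-- Polar coordinates for a radial function. -/
theorem lintegral_radial {f : ℝ → ℝ≥0∞} (hf : Measurable f) :
    ∫⁻ z : ℂ, f ‖z‖ =
      ENNReal.ofReal (2 * Real.pi) * ∫⁻ r in Set.Ioi (0 : ℝ), ENNReal.ofReal r * f r := by
  rw [← Complex.lintegral_comp_polarCoord_symm]
  have hm : Measurable fun r : ℝ => ENNReal.ofReal r * f r := by fun_prop
  have h : ∀ p ∈ polarCoord.target,
      ENNReal.ofReal p.1 • f ‖Complex.polarCoord.symm p‖ = (ENNReal.ofReal p.1 * f p.1) * 1 := by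
    intro p hp
    rw [polarCoord_target] at hp
    rw [Complex.norm_polarCoord_symm, abs_of_pos hp.1, smul_eq_mul, mul_one]
  rw [setLIntegral_congr_fun polarCoord.open_target.measurableSet h, polarCoord_target,
    Measure.volume_eq_prod, ← Measure.prod_restrict, lintegral_prod_mul hm.aemeasurable
      aemeasurable_const, mul_comm]
  congr 1
  simp [two_mul]

/-- The substitution `s = r ^ 2` for radial integrals on `ℂ`. -/
theorem lintegral_norm_sq {g : ℝ → ℝ≥0∞} (hg : Measurable g) :
    ∫⁻ z : ℂ, 2 * ‖z‖ₑ ^ 2 * g (‖z‖ ^ 2) = ∫⁻ z : ℂ, g ‖z‖ := by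
  have h2 : ∀ z : ℂ, 2 * ‖z‖ₑ ^ 2 * g (‖z‖ ^ 2) =
      (fun r : ℝ => 2 * ENNReal.ofReal r ^ 2 * g (r ^ 2)) ‖z‖ := fun z => by
    simp only [ofReal_norm]
  rw [lintegral_congr h2,
    lintegral_radial (f := fun r : ℝ => 2 * ENNReal.ofReal r ^ 2 * g (r ^ 2)) (by fun_prop),
    lintegral_radial hg]
  congr 1
  have himg : (fun r : ℝ => r ^ 2) '' Set.Ioi 0 = Set.Ioi 0 := by
    ext s
    constructor
    · rintro ⟨r, hr, rfl⟩
      exact pow_pos (Set.mem_Ioi.1 hr) 2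
    · exact fun hs => ⟨√s, Real.sqrt_pos.2 hs, Real.sq_sqrt (le_of_lt hs)⟩
  have hinj : Set.InjOn (fun r : ℝ => r ^ 2) (Set.Ioi 0) := fun a ha b hb h =>
    (pow_left_inj₀ (le_of_lt ha) (le_of_lt hb) two_ne_zero).1 h
  conv_rhs => rw [← himg]
  rw [lintegral_image_eq_lintegral_abs_deriv_mul measurableSet_Ioi (f' := fun r => 2 * r)
    (fun r _ => by simpa using (hasDerivAt_pow 2 r).hasDerivWithinAt) hinj]
  refine setLIntegral_congr_fun measurableSet_Ioi fun r hr => ?_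
  have hr' : 0 < r := hr
  rw [abs_of_pos (by positivity), ENNReal.ofReal_mul zero_le_two, ENNReal.ofReal_pow hr'.le,
    ENNReal.ofReal_ofNat]
  ring

/-! ### The complex ensemble -/

/-- The rotation average of `|Δ(z)|²` is the permanent of `(|z_j| ^ (2 i))`: in the double Leibniz
expansion of `Δ(z) * conj Δ(z)` only the diagonal terms survive. -/
theorem sum_rotation_normal {N M : ℕ} {ζ : ℂ} (hζ : IsPrimitiveRoot ζ M) (hNM : N ≤ M)
    (z : Fin N → ℂ) :
    ∑ u : Fin N → Fin M, ∏ j, ∏ k ∈ Finset.Ioi j,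
        ‖ζ ^ (u k : ℕ) * z k - ζ ^ (u j : ℕ) * z j‖ₑ ^ 2 =
      (M : ℝ≥0∞) ^ N * ∑ σ : Equiv.Perm (Fin N), ∏ j, ‖z j‖ₑ ^ (2 * (σ j : ℕ)) := by
  have hV : ∀ v : Fin N → ℂ, ((∏ j, ∏ k ∈ Finset.Ioi j, ‖v k - v j‖ ^ 2 : ℝ) : ℂ) =
      ∑ s : Equiv.Perm (Fin N) × Equiv.Perm (Fin N),
        (((Equiv.Perm.sign s.1 : ℤ) : ℂ) * ((Equiv.Perm.sign s.2 : ℤ) : ℂ)) *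
          ∏ j, (v j ^ (s.1 j : ℕ) * conj (v j) ^ (s.2 j : ℕ)) := by
    intro v
    have h1 := Matrix.det_vandermonde v
    rw [← Matrix.det_transpose, Matrix.det_apply'] at h1
    simp only [Matrix.transpose_apply, Matrix.vandermonde_apply] at h1
    have h2 := congrArg conj h1
    simp only [map_sum, map_mul, map_prod, map_pow, map_intCast] at h2
    push_cast
    simp only [← Complex.mul_conj', Finset.prod_mul_distrib, map_sub] at h2 ⊢
    rw [← h1, ← h2, Finset.sum_mul_sum, Fintype.sum_prod_type]
    refine Finset.sum_congr rfl fun s _ => Finset.sum_congr rfl fun t _ => ?_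
    ring
  have hC : ((∑ u : Fin N → Fin M, ∏ j, ∏ k ∈ Finset.Ioi j,
        ‖ζ ^ (u k : ℕ) * z k - ζ ^ (u j : ℕ) * z j‖ ^ 2 : ℝ) : ℂ) =
      (((M : ℝ) ^ N * ∑ σ : Equiv.Perm (Fin N), ∏ j, ‖z j‖ ^ (2 * (σ j : ℕ)) : ℝ) : ℂ) := by
    rw [Complex.ofReal_sum]
    simp only [hV]
    rw [sum_rotation_prod (fun s : Equiv.Perm (Fin N) × Equiv.Perm (Fin N) => _)
      (fun s j x => x ^ (s.1 j : ℕ) * conj x ^ (s.2 j : ℕ)), Fintype.sum_prod_type]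
    simp only [sum_rotation_monomial hζ _ ((Fin.is_lt _).trans_le hNM)
      ((Fin.is_lt _).trans_le hNM)]
    push_cast
    rw [Finset.mul_sum]
    refine Finset.sum_congr rfl fun σ _ => ?_
    rw [Finset.sum_eq_single σ]
    · simp only [if_true, Finset.prod_mul_distrib]
      rw [← Int.cast_mul, ← Units.val_mul, Int.units_mul_self]
      simp
    -- Off the diagonal some coordinate carries two different exponents.
    · intro τ _ hτ
      obtain ⟨j, hj⟩ : ∃ j, σ j ≠ τ j := by
        by_contra! h
        exact hτ (Equiv.ext fun j => (h j).symm)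
      rw [Finset.prod_eq_zero (Finset.mem_univ j), mul_zero]
      rw [if_neg (fun h => hj (Fin.ext h))]
    · simp
  have hR := Complex.ofReal_injective hC
  simp only [enorm_eq_nnnorm]
  simp only [← coe_nnnorm] at hR
  exact_mod_cast hR

/-! ### The Vandermonde determinant of interlaced variables -/

/-- The Vandermonde determinant in the `2 N` variables `a 0, b 0, a 1, b 1, …`. The position
`2 j + c` is encoded by the pair `(j, c) : Fin N × Fin 2`. -/
theorem det_vandermonde_pairs {R : Type*} [CommRing R] {N : ℕ} (a b : Fin N → R) :
    (Matrix.of fun x y : Fin N × Fin 2 =>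
      (if x.2 = 0 then a x.1 else b x.1) ^ ((y.2 : ℕ) + 2 * (y.1 : ℕ))).det =
      (∏ j, (b j - a j)) * ∏ j, ∏ k ∈ Finset.Ioi j,
        (a k - a j) * (b k - a j) * ((a k - b j) * (b k - b j)) := by
  set v : Fin N × Fin 2 → R := fun x => if x.2 = 0 then a x.1 else b x.1 with hv
  -- `finProdFinEquiv` sends `(j, c)` to `c + 2 j`.
  have hsub : (Matrix.of fun x y : Fin N × Fin 2 => v x ^ ((y.2 : ℕ) + 2 * (y.1 : ℕ))) =
      (Matrix.vandermonde (v ∘ finProdFinEquiv.symm)).submatrix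
        finProdFinEquiv finProdFinEquiv := by
    ext x y
    simp [Matrix.vandermonde_apply]
  have hIoi : ∀ (n : ℕ) (f : Fin n → Fin n → R),
      ∏ j, ∏ k ∈ Finset.Ioi j, f j k = ∏ j, ∏ k, if j < k then f j k else 1 := by
    intro n f
    refine Finset.prod_congr rfl fun j _ => ?_
    rw [← Finset.prod_filter]
    congr 1
    ext k
    simp
  -- The factors within a block are spread over all pairs `(j, k)`, so that the two sides can be
  -- compared pair by pair.
  have hdiag : ∏ j, (b j - a j) = ∏ j, ∏ k, if j = k then b k - a j else 1 := by simp
  rw [hsub, Matrix.det_submatrix_equiv_self, Matrix.det_vandermonde, hIoi, hIoi, hdiag,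
    ← Finset.prod_mul_distrib, ← finProdFinEquiv.prod_comp, Fintype.prod_prod_type]
  refine Finset.prod_congr rfl fun j _ => ?_
  simp only [← finProdFinEquiv.prod_comp, Fintype.prod_prod_type, Fin.prod_univ_two,
    ← Finset.prod_mul_distrib]
  refine Finset.prod_congr rfl fun k _ => ?_
  simp only [Function.comp_apply, Equiv.symm_apply_apply, Fin.lt_def, finProdFinEquiv_apply_val, hv,
    Fin.ext_iff, Fin.val_zero, Fin.val_one]
  rcases lt_trichotomy (j : ℕ) k with h | h | h
  · rw [if_pos (by omega : 0 + 2 * (j : ℕ) < 0 + 2 * k),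
      if_pos (by omega : 0 + 2 * (j : ℕ) < 1 + 2 * k),
      if_pos (by omega : 1 + 2 * (j : ℕ) < 0 + 2 * k),
      if_pos (by omega : 1 + 2 * (j : ℕ) < 1 + 2 * k), if_neg h.ne, if_pos h]
    simp
  · obtain rfl : j = k := Fin.ext h
    simp
  · rw [if_neg (by omega : ¬0 + 2 * (j : ℕ) < 0 + 2 * k),
      if_neg (by omega : ¬0 + 2 * (j : ℕ) < 1 + 2 * k),
      if_neg (by omega : ¬1 + 2 * (j : ℕ) < 0 + 2 * k),
      if_neg (by omega : ¬1 + 2 * (j : ℕ) < 1 + 2 * k), if_neg h.ne', if_neg h.not_gt]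
    simp

/-! ### Permutations preserving consecutive pairs -/

/-- The permutation of `Fin N × Fin 2` that permutes the blocks `{j} × Fin 2` by `s.1` and, within
the block at `j`, permutes the second coordinate by `s.2 j`. -/
def blockPerm {N : ℕ} (s : Equiv.Perm (Fin N) × (Fin N → Equiv.Perm (Fin 2))) :
    Equiv.Perm (Fin N × Fin 2) :=
  Equiv.prodCongrLeft (fun _ => s.1) * Equiv.prodCongrRight s.2

theorem blockPerm_apply {N : ℕ} (s : Equiv.Perm (Fin N) × (Fin N → Equiv.Perm (Fin 2)))
    (x : Fin N × Fin 2) : blockPerm s x = (s.1 x.1, s.2 x.1 x.2) := rfl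

theorem sign_blockPerm {N : ℕ} (s : Equiv.Perm (Fin N) × (Fin N → Equiv.Perm (Fin 2))) :
    Equiv.Perm.sign (blockPerm s) = ∏ j, Equiv.Perm.sign (s.2 j) := by
  rw [blockPerm, Equiv.Perm.sign_mul, Equiv.Perm.sign_prodCongrLeft,
    Equiv.Perm.sign_prodCongrRight, Fin.prod_univ_two, Int.units_mul_self, one_mul]

theorem blockPerm_injective {N : ℕ} : Function.Injective (blockPerm (N := N)) := by
  intro s t h
  have h' : ∀ j b, s.1 j = t.1 j ∧ s.2 j b = t.2 j b := fun j b =>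
    Prod.ext_iff.1 (Equiv.congr_fun h (j, b))
  exact Prod.ext (Equiv.ext fun j => (h' j 0).1) (funext fun j => Equiv.ext fun b => (h' j b).2)

/-- A permutation that sends each block into a single block is a block permutation. -/
theorem mem_range_blockPerm {N : ℕ} {π : Equiv.Perm (Fin N × Fin 2)}
    (h : ∀ j, (π (j, 0)).1 = (π (j, 1)).1) : π ∈ Set.range blockPerm := by
  have h' : ∀ j b, (π (j, b)).1 = (π (j, 0)).1 := by
    intro j b
    fin_cases b
    · rfl
    · exact (h j).symm
  have hsurj : Function.Surjective fun j => (π (j, 0)).1 := by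
    intro m
    refine ⟨(π.symm (m, 0)).1, ?_⟩
    change (π (_, 0)).1 = m
    rw [← h' _ (π.symm (m, 0)).2, Prod.mk.eta, Equiv.apply_symm_apply]
  have hinj : ∀ j, Function.Injective fun b => (π (j, b)).2 := by
    intro j b c hbc
    have : π (j, b) = π (j, c) := Prod.ext ((h' j b).trans (h' j c).symm) hbc
    simpa using this
  refine ⟨(Equiv.ofBijective _ (Finite.surjective_iff_bijective.1 hsurj), fun j =>
    Equiv.ofBijective _ (Finite.injective_iff_bijective.1 (hinj j))), Equiv.ext fun x => ?_⟩
  exact Prod.ext (h' x.1 x.2).symm rfl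

/-- If a permutation of `{0, …, 2 N - 1}` sends each pair `{2 j, 2 j + 1}` to two consecutive
numbers, then it permutes these pairs: the only perfect matching of `0, …, 2 N - 1` into consecutive
numbers is `{0, 1}, {2, 3}, …`. -/
theorem mem_range_blockPerm_of_consecutive {N : ℕ} {π : Equiv.Perm (Fin N × Fin 2)}
    (h : ∀ j, ((π (j, 0)).2 : ℕ) + 2 * (π (j, 0)).1 + 1 = (π (j, 1)).2 + 2 * (π (j, 1)).1 ∨
      ((π (j, 0)).2 : ℕ) + 2 * (π (j, 0)).1 = (π (j, 1)).2 + 2 * (π (j, 1)).1 + 1) :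
    π ∈ Set.range blockPerm := by
  have hb : ∀ j b, ((π (j, b)).2 : ℕ) + 2 * (π (j, b)).1 + 1 =
        (π (j, b + 1)).2 + 2 * (π (j, b + 1)).1 ∨
      ((π (j, b)).2 : ℕ) + 2 * (π (j, b)).1 = (π (j, b + 1)).2 + 2 * (π (j, b + 1)).1 + 1 := by
    intro j b
    fin_cases b
    · exact h j
    · exact (h j).symm.imp Eq.symm Eq.symm
  -- By induction on `m`, the value `2 m` is matched with `2 m + 1`, since `2 m - 1` is already
  -- matched with `2 m - 2`.
  have key : ∀ (m : ℕ) (j : Fin N) (b : Fin 2),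
      ((π (j, b)).2 : ℕ) + 2 * (π (j, b)).1 = 2 * m →
      ((π (j, b + 1)).2 : ℕ) + 2 * (π (j, b + 1)).1 = 2 * m + 1 := by
    intro m
    induction m with
    | zero => intro j b hj; have := hb j b; omega
    | succ m ih =>
      intro j b hj
      rcases hb j b with h1 | h1
      · omega
      · exfalso
        have hm : m < N := by have := (π (j, b)).1.is_lt; have := (π (j, b)).2.is_lt; omega
        obtain ⟨⟨k, c⟩, hk⟩ := π.surjective (⟨m, hm⟩, 0)
        have h2 := ih k c (by simp [hk])
        have h3 : π (k, c + 1) = π (j, b + 1) := by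
          have := (π (k, c + 1)).2.is_lt
          have := (π (j, b + 1)).2.is_lt
          exact Prod.ext (Fin.ext (by omega)) (Fin.ext (by omega))
        have h4 := π.injective h3
        simp only [Prod.mk.injEq, add_left_inj] at h4
        rw [← h4.1, ← h4.2, hk] at hj
        simp at hj
  refine mem_range_blockPerm fun j => Fin.ext ?_
  have e0 := (π (j, 0)).2.is_lt
  have e1 := (π (j, 1)).2.is_lt
  rcases h j with h1 | h1
  · rcases Nat.even_or_odd' ((π (j, 1)).2 + 2 * (π (j, 1)).1 : ℕ) with ⟨m, hm | hm⟩
    · have := key m j 1 hm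
      rw [show (1 : Fin 2) + 1 = 0 from rfl] at this
      omega
    · omega
  · rcases Nat.even_or_odd' ((π (j, 0)).2 + 2 * (π (j, 0)).1 : ℕ) with ⟨m, hm | hm⟩
    · have := key m j 0 hm
      rw [zero_add] at this
      omega
    · omega

/-! ### The symplectic ensemble -/

/-- The monomials `z ^ a` and `z ^ b` pair nontrivially in the rotation-averaged skew form
`(z ^ a * conj z ^ b) * (z - conj z)` only if `a` and `b` are consecutive. -/
theorem sum_rotation_skew {M : ℕ} {ζ : ℂ} (hζ : IsPrimitiveRoot ζ M) (z : ℂ) {a b : ℕ}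
    (ha : a + 1 < M) (hb : b + 1 < M) :
    ∑ k : Fin M, (ζ ^ (k : ℕ) * z) ^ a * conj (ζ ^ (k : ℕ) * z) ^ b *
        (ζ ^ (k : ℕ) * z - conj (ζ ^ (k : ℕ) * z)) =
      (if a + 1 = b then (M : ℂ) * ((‖z‖ : ℝ) : ℂ) ^ (2 * b) else 0) -
        if a = b + 1 then (M : ℂ) * ((‖z‖ : ℝ) : ℂ) ^ (2 * a) else 0 := by
  rw [← sum_rotation_monomial hζ z (by omega) hb]
  have := sum_rotation_monomial hζ z ha (b := b) (by omega)
  rw [show (if a + 1 = b then (M : ℂ) * ((‖z‖ : ℝ) : ℂ) ^ (2 * b) else 0) =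
    if a + 1 = b then (M : ℂ) * ((‖z‖ : ℝ) : ℂ) ^ (2 * (a + 1)) else 0 by
      split_ifs with h
      · rw [h]
      · rfl, ← this, ← Finset.sum_sub_distrib]
  refine Finset.sum_congr rfl fun k _ => ?_
  ring

/-- The rotation average of the symplectic density is the permanent of
`(2 |z_j| ^ (2 (2 i + 1)))`. The factor averaged is `∏ (z_j - conj z_j)` times the Vandermonde
determinant in `z_1, conj z_1, …, z_N, conj z_N`, and only block permutations survive in its Leibniz
expansion. The sign of such a permutation is the product of the signs inside the blocks,
which cancels the sign of the surviving skew monomials. -/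
theorem sum_rotation_symplectic {N M : ℕ} {ζ : ℂ} (hζ : IsPrimitiveRoot ζ M) (hNM : 2 * N < M)
    (z : Fin N → ℂ) :
    ∑ u : Fin N → Fin M,
      (∏ j, ‖ζ ^ (u j : ℕ) * z j - conj (ζ ^ (u j : ℕ) * z j)‖ₑ ^ 2) *
      ∏ j, ∏ k ∈ Finset.Ioi j, ‖ζ ^ (u k : ℕ) * z k - ζ ^ (u j : ℕ) * z j‖ₑ ^ 2 *
        ‖ζ ^ (u k : ℕ) * z k - conj (ζ ^ (u j : ℕ) * z j)‖ₑ ^ 2 =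
      (M : ℝ≥0∞) ^ N * ∑ σ : Equiv.Perm (Fin N),
        ∏ j, (2 * ‖z j‖ₑ ^ (2 * (2 * (σ j : ℕ) + 1))) := by
  have hV : ∀ v : Fin N → ℂ, (((∏ j, ‖v j - conj (v j)‖ ^ 2) *
      ∏ j, ∏ k ∈ Finset.Ioi j, ‖v k - v j‖ ^ 2 * ‖v k - conj (v j)‖ ^ 2 : ℝ) : ℂ) =
      ∑ π : Equiv.Perm (Fin N × Fin 2), ((Equiv.Perm.sign π : ℤ) : ℂ) *
        ∏ j, (v j ^ ((π (j, 0)).2 + 2 * (π (j, 0)).1 : ℕ) *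
          conj (v j) ^ ((π (j, 1)).2 + 2 * (π (j, 1)).1 : ℕ) * (v j - conj (v j))) := by
    intro v
    have h1 := det_vandermonde_pairs v fun j => conj (v j)
    rw [← Matrix.det_transpose, Matrix.det_apply'] at h1
    simp only [Matrix.transpose_apply, Matrix.of_apply, Fintype.prod_prod_type, Fin.prod_univ_two,
      if_true, if_neg one_ne_zero] at h1
    simp only [Finset.prod_mul_distrib (g := fun j => v j - conj (v j)), ← mul_assoc]
    simp only [← Finset.sum_mul, h1]
    push_cast
    simp only [← Complex.mul_conj', map_sub, Complex.conj_conj]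
    rw [mul_right_comm]
    simp only [← Finset.prod_mul_distrib]
    refine Finset.prod_congr rfl fun j _ => congrArg₂ _ (mul_comm _ _) ?_
    exact Finset.prod_congr rfl fun k _ => by ring
  have hC : ((∑ u : Fin N → Fin M,
      (∏ j, ‖ζ ^ (u j : ℕ) * z j - conj (ζ ^ (u j : ℕ) * z j)‖ ^ 2) *
      ∏ j, ∏ k ∈ Finset.Ioi j, ‖ζ ^ (u k : ℕ) * z k - ζ ^ (u j : ℕ) * z j‖ ^ 2 *
        ‖ζ ^ (u k : ℕ) * z k - conj (ζ ^ (u j : ℕ) * z j)‖ ^ 2 : ℝ) : ℂ) =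
      (((M : ℝ) ^ N * ∑ σ : Equiv.Perm (Fin N),
        ∏ j, (2 * ‖z j‖ ^ (2 * (2 * (σ j : ℕ) + 1))) : ℝ) : ℂ) := by
    rw [Complex.ofReal_sum]
    simp only [hV]
    rw [sum_rotation_prod (fun π : Equiv.Perm (Fin N × Fin 2) => _)
      (fun π j x => x ^ ((π (j, 0)).2 + 2 * (π (j, 0)).1 : ℕ) *
          conj x ^ ((π (j, 1)).2 + 2 * (π (j, 1)).1 : ℕ) * (x - conj x))]
    -- The factor `z - conj z` raises an exponent by one, up to `2 N` at most.
    have hlt : ∀ x : Fin N × Fin 2, (x.2 : ℕ) + 2 * x.1 + 1 < M := fun x => by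
      have := x.1.is_lt; have := x.2.is_lt; omega
    simp only [sum_rotation_skew hζ _ (hlt _) (hlt _)]
    rw [← Fintype.sum_of_injective blockPerm blockPerm_injective (fun s =>
      ∏ j, ((M : ℂ) * ((‖z j‖ : ℝ) : ℂ) ^ (2 * (2 * (s.1 j : ℕ) + 1))))]
    · simp only [Fintype.sum_prod_type, Finset.sum_const, Finset.prod_mul_distrib]
      push_cast
      simp [Fintype.card_perm, Finset.mul_sum]
      refine Finset.sum_congr rfl fun σ _ => ?_
      ring
    · intro π hπ
      obtain ⟨j, hj⟩ := not_forall.1 fun h => hπ (mem_range_blockPerm_of_consecutive h)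
      rw [not_or] at hj
      rw [Finset.prod_eq_zero (Finset.mem_univ j), mul_zero]
      rw [if_neg hj.1, if_neg hj.2, sub_zero]
    · intro s
      rw [sign_blockPerm]
      push_cast
      rw [← Finset.prod_mul_distrib]
      refine Finset.prod_congr rfl fun j _ => ?_
      have h2 : ∀ e : Equiv.Perm (Fin 2), e = 1 ∨ e = Equiv.swap 0 1 := by decide
      rcases h2 (s.2 j) with h | h <;> simp [blockPerm_apply, h, add_comm] <;>
        rw [if_neg (by omega), sub_zero]
  have hR := Complex.ofReal_injective hC
  simp only [enorm_eq_nnnorm]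
  simp only [← coe_nnnorm] at hR
  exact_mod_cast hR

/-! ### Partition functions as products of moments -/

theorem normalPartitionFunction_eq_prod {N : ℕ} {W : ℂ → EReal} (hW : Measurable W)
    (hrad : ∀ c z, ‖c‖ = 1 → W (c * z) = W z) :
    normalPartitionFunction N W =
      ∏ i : Fin N, ∫⁻ z, EReal.exp (-W z) * ‖z‖ₑ ^ (2 * (i : ℕ)) := by
  have hζ := Complex.isPrimitiveRoot_exp (N + 1) N.succ_ne_zero
  have hw : Measurable fun z => EReal.exp (-W z) := hW.neg.ereal_exp
  rw [normalPartitionFunction, lintegral_eq_of_sum_rotation_eq N.succ_ne_zero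
    (hζ.norm'_eq_one N.succ_ne_zero) hw (fun c z hc => by rw [hrad c z hc]) (by fun_prop)
    (sum_rotation_normal hζ N.le_succ),
    lintegral_sum_perm_eq hw (q := fun i z => ‖z‖ₑ ^ (2 * (i : ℕ))) (fun i => by fun_prop),
    ← mul_assoc, ENNReal.inv_mul_cancel (by exact_mod_cast N.factorial_ne_zero)
      (ENNReal.natCast_ne_top _), one_mul]

theorem symplecticPartitionFunction_eq_prod {N : ℕ} {W : ℂ → EReal} (hW : Measurable W)
    (hrad : ∀ c z, ‖c‖ = 1 → W (c * z) = W z) :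
    symplecticPartitionFunction N W =
      ∏ i : Fin N, ∫⁻ z, EReal.exp (-(2 * W z)) * (2 * ‖z‖ₑ ^ (2 * (2 * (i : ℕ) + 1))) := by
  have hζ := Complex.isPrimitiveRoot_exp (2 * N + 1) (2 * N).succ_ne_zero
  have hw : Measurable fun z => EReal.exp (-(2 * W z)) := (hW.const_mul 2).neg.ereal_exp
  rw [symplecticPartitionFunction, lintegral_congr fun z => by
      rw [Finset.prod_mul_distrib (f := fun j => EReal.exp (-(2 * W (z j)))), mul_assoc],
    lintegral_eq_of_sum_rotation_eq (2 * N).succ_ne_zero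
    (hζ.norm'_eq_one (2 * N).succ_ne_zero) hw (fun c z hc => by rw [hrad c z hc]) (by fun_prop)
    (sum_rotation_symplectic hζ (2 * N).lt_succ_self),
    lintegral_sum_perm_eq hw (q := fun i z => 2 * ‖z‖ₑ ^ (2 * (2 * (i : ℕ) + 1)))
      (fun i => by fun_prop),
    ← mul_assoc, ENNReal.inv_mul_cancel (by exact_mod_cast N.factorial_ne_zero)
      (ENNReal.natCast_ne_top _), one_mul]

theorem mainTheorem3 (N : ℕ) (ω : ℝ≥0 → EReal) (hω : Measurable ω) (WC WH : ℂ → EReal)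
    (hWC : ∀ z, WC z = ω ‖z‖₊)
    (hWH : ∀ z, WH z = ((1 / 2 : ℝ) : EReal) * ω (‖z‖₊ ^ 2)) :
    symplecticPartitionFunction N WH = normalPartitionFunction N WC := by
  have hnn : ∀ c z : ℂ, ‖c‖ = 1 → ‖c * z‖₊ = ‖z‖₊ := fun c z hc => by
    rw [nnnorm_mul, show ‖c‖₊ = 1 from NNReal.eq hc, one_mul]
  obtain rfl : WC = fun z => ω ‖z‖₊ := funext hWC
  obtain rfl : WH = fun z => ((1 / 2 : ℝ) : EReal) * ω (‖z‖₊ ^ 2) := funext hWH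
  have hH : Measurable fun z : ℂ => ((1 / 2 : ℝ) : EReal) * ω (‖z‖₊ ^ 2) :=
    (hω.comp (measurable_nnnorm.pow_const 2)).const_mul _
  have hC : Measurable fun z : ℂ => ω ‖z‖₊ := hω.comp measurable_nnnorm
  rw [symplecticPartitionFunction_eq_prod hH (fun c z hc => by rw [hnn c z hc]),
    normalPartitionFunction_eq_prod hC (fun c z hc => by rw [hnn c z hc])]
  refine Finset.prod_congr rfl fun i _ => ?_
  have hg : Measurable fun r : ℝ =>
      EReal.exp (-ω r.toNNReal) * ENNReal.ofReal r ^ (2 * (i : ℕ)) :=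
    (hω.comp measurable_real_toNNReal).neg.ereal_exp.mul (by fun_prop)
  -- This holds at `x = ⊤` and `x = ⊥` too, by associativity in `EReal`.
  have h2 : ∀ x : EReal, 2 * (((1 / 2 : ℝ) : EReal) * x) = x := fun x => by
    rw [← mul_assoc, show (2 : EReal) = ((2 : ℝ) : EReal) from rfl, ← EReal.coe_mul]
    norm_num
  convert lintegral_norm_sq hg using 1
  · refine lintegral_congr fun z => ?_
    rw [h2, Real.toNNReal_pow (norm_nonneg z), norm_toNNReal, ENNReal.ofReal_pow (norm_nonneg z),
      ofReal_norm]
    ring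
  · refine lintegral_congr fun z => ?_
    rw [norm_toNNReal, ofReal_norm]
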